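/- Write $t=\ln x$. A Dulac series is a formal series $\varphi=\sum_{k\ge 1}c_k(t)\,x^{\lambda_k}$ with $c_k\in\mathbb{C}[t]$, $\lambda_k\in\mathbb{C}$, $0<\operatorname{Re}\lambda_1\le\operatorname{Re}\lambda_2\le\dots$ and $\operatorname{Re}\lambda_k\to\infty$; its exponents are the $\lambda$ for which the coefficient of $x^{\lambda}$ is a nonzero polynomial. Let $\delta=x\,d/dx$ act on such series by $\delta\bigl(\sum c_k(t)x^{\lambda_k}\bigr)=\sum(\lambda_k+\tfrac{d}{dt})c_k(t)\,x^{\lambda_k}$. If $H$ is holomorphic near $0\in\mathbb{C}^{n+2}$, then $H(x,\varphi,\delta\varphi,\dots,\delta^n\varphi)$ denotes the formal series obtained by substituting $x,\varphi,\delta\varphi,\dots,\delta^n\varphi$ into the Taylor series of $H$ at $0$. **Theorem 2.** Let $n\ge 0$, let $F(x,y_0,\dots,y_n)\not\equiv 0$ be holomorphic near $0\in\mathbb{C}^{n+2}$ with $F(0)=0$, and let $\varphi\ne 0$ be a Dulac series that is a formal solution of $F(x,y,\delta y,\dots,\delta^n y)=0$, that is, all coefficients of $F(x,\varphi,\delta\varphi,\dots,\delta^n\varphi)$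 vanish. Suppose that $F'_{y_n}(x,\varphi,\dots,\delta^n\varphi)\not\equiv 0$ and that there are $\nu\in\mathbb{C}$ and constants $A_0,\dots,A_n\in\mathbb{C}$, not all zero, such that for every $j=0,\dots,n$ $$F'_{y_j}(x,\varphi,\dots,\delta^n\varphi)=A_j\,x^{\nu}+(\text{terms whose exponents have real part}>\operatorname{Re}\nu).$$ Let $\ell=\max\{j: A_j\ne 0\}$. Then there exist $\kappa\in\mathbb{N}$ and complex numbers $r_1,\dots,r_\kappa$ with positive real parts, linearly independent over $\mathbb{Z}$, such that the finitely generated additive semigroup $$G=\Bigl\{\sum_{j=1}^{\kappa}m_jr_j \;\Big|\; m\in\mathbb{Z}_{\ge 0}^{\kappa}\setminus\{0\}\Bigr\}$$ has the following properties. 1. $1\in G$. If $\ell<n$, then also $(n-\ell)s\in G$, where $s=\min_{j>\ell}\frac{\operatorname{Re}\nu_j-\operatorname{Re}\nu}{j-\ell}$; here $\operatorname{Re}\nu_j$ is the smallest real part of an exponent of $F'_{y_j}(x,\varphi,\dots,\delta^n\varphi)$, and the minimum is over those $j>\ell$ for which this series is nonzero. 2. All exponents of $\varphi$ lie in $G$,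 that is, $\varphi\in\mathbb{C}[t][[x^{G}]]$, the ring (without unit) of Dulac series with all exponents in $G$. 3. The map $$\iota:\ \sum_{m\ne 0}C_m(t)\,x^{m_1r_1+\dots+m_\kappa r_\kappa}\ \longmapsto\ \sum_{m\ne 0}C_m(t)\,x_1^{m_1}\cdots x_\kappa^{m_\kappa}$$ is a well-defined ring isomorphism from $\mathbb{C}[t][[x^{G}]]$ onto the ring (without unit) of formal power series in $\kappa$ variables over $\mathbb{C}[t]$ with zero constant term. In particular, $\varphi$ is identified with the formal power series $\iota(\varphi)$ in $\kappa$ variables. -/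

import Mathlib

noncomputable section

namespace Dulac

/-- Complex exponents `λ`, recorded as `(Re λ, Im λ)` and ordered lexicographically. The order only
serves to place formal series inside Mathlib's Hahn series. -/
abbrev Expo : Type := Lex (ℝ × ℝ)

/-- The exponent `λ ∈ ℂ` as an element of `Expo`. -/
def expo (z : ℂ) : Expo := toLex (z.re, z.im)

/-- Formal series `∑ c_λ(t) x^λ` with complex exponents and coefficients in `ℂ[t]`, with the usual
(Cauchy) multiplication. Dulac series are singled out below by `IsDulac`. -/
abbrev FormalSeries : Type := HahnSeries Expo (Polynomial ℂ)

/-- The coefficient `c_λ(t)` of `x^λ`. -/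
def coeffAt (φ : FormalSeries) (z : ℂ) : Polynomial ℂ := φ.coeff (expo z)

/-- The set of (actual) exponents: those `λ` for which `c_λ(t) ≢ 0`. -/
def exponents (φ : FormalSeries) : Set ℂ := {z | coeffAt φ z ≠ 0}

/-- Dulac series: all exponents have positive real part, and only finitely many exponents have
real part at most `N`, for each `N`. -/
def IsDulac (φ : FormalSeries) : Prop :=
  (∀ z ∈ exponents φ, 0 < z.re) ∧ ∀ N : ℝ, {z ∈ exponents φ | z.re ≤ N}.Finite

/-- The monomial `x`. -/
def varX : FormalSeries := HahnSeries.single (expo 1) 1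

/-- The derivation `δ = x d/dx`, with `t = ln x`:
`δ (∑ c_λ(t) x^λ) = ∑ (λ + d/dt) c_λ(t) x^λ`. -/
def delta (φ : FormalSeries) : FormalSeries where
  coeff e := Polynomial.C (⟨(ofLex e).1, (ofLex e).2⟩ : ℂ) * φ.coeff e
    + Polynomial.derivative (φ.coeff e)
  isPWO_support' := φ.isPWO_support.mono fun e he h => he (by simp [h])

/-- The degree `d` homogeneous part of the Taylor expansion of `F` at the origin, evaluated at a
tuple `Φ` of formal series:
`(1/d!) ∑_{i₁,…,i_d} (∂_{i₁} ⋯ ∂_{i_d} F)(0) Φ_{i₁} ⋯ Φ_{i_d}`. -/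
def taylorPart {N : ℕ} (F : (Fin N → ℂ) → ℂ) (Φ : Fin N → FormalSeries) (d : ℕ) : FormalSeries :=
  ∑ i : Fin d → Fin N,
    ((d.factorial : ℂ)⁻¹ * iteratedFDeriv ℂ d F 0 (fun k => Pi.single (i k) 1)) • ∏ k, Φ (i k)

/-- The coefficient of `x^z` in `F(Φ) = ∑_d F_d(Φ)`. For Dulac series `Φ_i` the sum over `d` is
finite, see `finite_support_taylorPart`. -/
def substCoeff {N : ℕ} (F : (Fin N → ℂ) → ℂ) (Φ : Fin N → FormalSeries) (z : ℂ) : Polynomial ℂ :=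
  ∑ᶠ d : ℕ, coeffAt (taylorPart F Φ d) z

/-- The tuple `(x, φ, δ φ, …, δⁿ φ)`. -/
def jet (n : ℕ) (φ : FormalSeries) : Fin (n + 2) → FormalSeries :=
  Fin.cons varX fun j : Fin (n + 1) => delta^[j] φ

/-- The partial derivative `∂F/∂y_j` of `F(x, y_0, …, y_n)`. -/
def partialY {n : ℕ} (F : (Fin (n + 2) → ℂ) → ℂ) (j : Fin (n + 1)) : (Fin (n + 2) → ℂ) → ℂ :=
  fun p => fderiv ℂ F p (Pi.single j.succ 1)

/-- `φ` is a formal solution of `F(x, y, δ y, …, δⁿ y) = 0`. -/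
def IsFormalSolution {n : ℕ} (F : (Fin (n + 2) → ℂ) → ℂ) (φ : FormalSeries) : Prop :=
  ∀ z : ℂ, substCoeff F (jet n φ) z = 0

/-- `F'_{y_j}(x, φ, …, δⁿ φ) = A x^ν + (terms whose exponents have real part > Re ν)`, with `A` a
constant (possibly zero). -/
def HasLeadingTerm {n : ℕ} (F : (Fin (n + 2) → ℂ) → ℂ) (φ : FormalSeries) (j : Fin (n + 1))
    (ν A : ℂ) : Prop :=
  substCoeff (partialY F j) (jet n φ) ν = Polynomial.C A ∧
    ∀ z : ℂ, z ≠ ν → substCoeff (partialY F j) (jet n φ) z ≠ 0 → ν.re < z.re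

/-- The quotients `(Re z - Re ν) / (j - ℓ)`, where `j > ℓ` and `z` is an exponent of
`F'_{y_j}(x, φ, …, δⁿ φ)`. If `ℓ` is the last index with `A_ℓ ≠ 0`, the least one is
`min_{j > ℓ} (Re ν_j - Re ν) / (j - ℓ)`. -/
def slopeSet {n : ℕ} (F : (Fin (n + 2) → ℂ) → ℂ) (φ : FormalSeries) (ν : ℂ) (l : Fin (n + 1)) :
    Set ℝ :=
  {q | ∃ j : Fin (n + 1), l < j ∧ ∃ z : ℂ, substCoeff (partialY F j) (jet n φ) z ≠ 0 ∧
    q = (z.re - ν.re) / ((j : ℝ) - (l : ℝ))}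

theorem exists_expo (e : Expo) : ∃ z : ℂ, expo z = e :=
  ⟨⟨(ofLex e).1, (ofLex e).2⟩, rfl⟩

theorem expo_add (z w : ℂ) : expo (z + w) = expo z + expo w := rfl

theorem expo_injective : Function.Injective expo := fun z w h => by
  have h' : (z.re, z.im) = (w.re, w.im) := toLex.injective h
  exact Complex.ext (congrArg Prod.fst h') (congrArg Prod.snd h')

theorem exponents_add {φ ψ : FormalSeries} {z : ℂ} (hz : z ∈ exponents (φ + ψ)) :
    z ∈ exponents φ ∨ z ∈ exponents ψ := by
  by_contra! h
  simp only [exponents, coeffAt, Set.mem_ofPred_eq, not_not] at h hz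
  exact hz (by simp [h.1, h.2])

theorem exponents_mul {φ ψ : FormalSeries} {z : ℂ} (hz : z ∈ exponents (φ * ψ)) :
    ∃ u ∈ exponents φ, ∃ v ∈ exponents ψ, u + v = z := by
  have hz' : (φ * ψ).coeff (expo z) ≠ 0 := hz
  rw [HahnSeries.coeff_mul] at hz'
  obtain ⟨⟨a, b⟩, hab, -⟩ := Finset.exists_ne_zero_of_sum_ne_zero hz'
  obtain ⟨ha, hb, h⟩ := Finset.mem_antidiagonal.1 hab
  obtain ⟨u, rfl⟩ := exists_expo a
  obtain ⟨v, rfl⟩ := exists_expo b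
  exact ⟨u, ha, v, hb, expo_injective (by rw [expo_add]; exact h)⟩

theorem IsDulac.add {φ ψ : FormalSeries} (h : IsDulac φ) (h' : IsDulac ψ) : IsDulac (φ + ψ) :=
  ⟨fun z hz => (exponents_add hz).elim (h.1 z) (h'.1 z), fun N =>
    ((h.2 N).union (h'.2 N)).subset fun _ hz => (exponents_add hz.1).imp (⟨·, hz.2⟩) (⟨·, hz.2⟩)⟩

theorem IsDulac.mul {φ ψ : FormalSeries} (h : IsDulac φ) (h' : IsDulac ψ) : IsDulac (φ * ψ) := by
  refine ⟨fun z hz => ?_, fun N => ?_⟩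
  · obtain ⟨u, hu, v, hv, rfl⟩ := exponents_mul hz
    exact add_pos (h.1 u hu) (h'.1 v hv)
  · refine (Set.Finite.image2 (· + ·) (h.2 N) (h'.2 N)).subset ?_
    rintro z ⟨hz, hN⟩
    obtain ⟨u, hu, v, hv, rfl⟩ := exponents_mul hz
    have h1 := h.1 u hu
    have h2 := h'.1 v hv
    rw [Complex.add_re] at hN
    exact ⟨u, ⟨hu, by linarith⟩, v, ⟨hv, by linarith⟩, rfl⟩

theorem isDulac_zero : IsDulac 0 := by
  simp [IsDulac, exponents, coeffAt]

theorem exponents_neg (φ : FormalSeries) : exponents (-φ) = exponents φ := by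
  simp [exponents, coeffAt]

/-- The additive semigroup `{∑ m_j r_j | m ∈ ℕ^κ ∖ {0}}` generated by `r_1, …, r_κ`. -/
def semigroupGen {κ : ℕ} (r : Fin κ → ℂ) : AddSubsemigroup ℂ where
  carrier := {z | ∃ m : Fin κ →₀ ℕ, m ≠ 0 ∧ z = ∑ j, (m j : ℂ) * r j}
  add_mem' := by
    rintro _ _ ⟨m, hm, rfl⟩ ⟨m', -, rfl⟩
    refine ⟨m + m', fun h => hm (add_eq_zero.1 h).1, ?_⟩
    simp [add_mul, Finset.sum_add_distrib]

/-- The ring `ℂ[t][[x^G]]` (without unit) of Dulac series all of whose exponents lie in `G`. -/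
def seriesRing (G : AddSubsemigroup ℂ) : NonUnitalSubring FormalSeries where
  carrier := {φ | IsDulac φ ∧ exponents φ ⊆ G}
  zero_mem' := ⟨isDulac_zero, by simp [exponents, coeffAt]⟩
  add_mem' := fun h h' => ⟨h.1.add h'.1, fun _ hz => (exponents_add hz).elim (h.2 ·) (h'.2 ·)⟩
  neg_mem' := fun {φ} h => by
    simpa only [Set.mem_ofPred_eq, IsDulac, exponents_neg] using h
  mul_mem' := fun h h' => ⟨h.1.mul h'.1, fun z hz => by
    obtain ⟨u, hu, v, hv, rfl⟩ := exponents_mul hz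
    exact G.add_mem (h.2 hu) (h'.2 hv)⟩

/-- The ring `ℂ[t][[x_1, …, x_κ]]_*` (without unit) of formal power series in `κ` variables over
`ℂ[t]` with zero constant term. -/
def powerSeriesRing (κ : ℕ) : NonUnitalSubring (MvPowerSeries (Fin κ) (Polynomial ℂ)) where
  carrier := {f | MvPowerSeries.constantCoeff f = 0}
  zero_mem' := by simp
  add_mem' := fun {f g} (hf : _ = _) (hg : _ = _) => by simp [hf, hg]
  neg_mem' := fun {f} (hf : _ = _) => by simp [hf]
  mul_mem' := fun {f g} (hf : _ = _) _ => by simp [hf]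

theorem IsDulac.exists_pos_le {φ : FormalSeries} (h : IsDulac φ) :
    ∃ c : ℝ, 0 < c ∧ ∀ z ∈ exponents φ, c ≤ z.re := by
  obtain hs | hs := ({z ∈ exponents φ | z.re ≤ 1} : Set ℂ).eq_empty_or_nonempty
  · refine ⟨1, one_pos, fun z hz => ?_⟩
    by_contra! hlt
    exact Set.eq_empty_iff_forall_notMem.1 hs z ⟨hz, hlt.le⟩
  · obtain ⟨w, hw, hmin⟩ := Set.exists_min_image _ Complex.re (h.2 1) hs
    refine ⟨w.re, h.1 w hw.1, fun z hz => ?_⟩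
    by_cases hz1 : z.re ≤ 1
    · exact hmin z ⟨hz, hz1⟩
    · exact hw.2.trans (not_le.1 hz1).le

theorem isDulac_varX : IsDulac varX := by
  have key : ∀ z ∈ exponents varX, z = 1 := fun z hz => by
    by_contra hne
    exact hz (HahnSeries.coeff_single_of_ne fun h => hne (expo_injective h))
  refine ⟨fun z hz => by simp [key z hz], fun N => ?_⟩
  exact (Set.finite_singleton (1 : ℂ)).subset fun z hz => key z hz.1

theorem exponents_delta (φ : FormalSeries) : exponents (delta φ) ⊆ exponents φ := by
  intro z hz h
  have h' : φ.coeff (expo z) = 0 := h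
  exact hz (by simp [coeffAt, delta, h'])

theorem IsDulac.delta {φ : FormalSeries} (h : IsDulac φ) : IsDulac (delta φ) :=
  ⟨fun z hz => h.1 z (exponents_delta φ hz),
    fun N => (h.2 N).subset fun _ hz => ⟨exponents_delta φ hz.1, hz.2⟩⟩

theorem IsDulac.jet {φ : FormalSeries} (h : IsDulac φ) (n : ℕ) (i : Fin (n + 2)) :
    IsDulac (jet n φ i) := by
  refine Fin.cases isDulac_varX (fun j => ?_) i
  have : ∀ k : ℕ, IsDulac (Dulac.delta^[k] φ) := fun k => by
    induction k with
    | zero => exact h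
    | succ k ih => rw [Function.iterate_succ_apply']; exact ih.delta
  exact this j

/-- Substitution of Dulac series into a Taylor series is well defined: only finitely many
homogeneous parts contribute to each coefficient. -/
theorem finite_support_taylorPart {N : ℕ} (F : (Fin N → ℂ) → ℂ) {Φ : Fin N → FormalSeries}
    (hΦ : ∀ i, IsDulac (Φ i)) (z : ℂ) :
    (Function.support fun d : ℕ => coeffAt (taylorPart F Φ d) z).Finite := by
  obtain ⟨c, hc, hcΦ⟩ : ∃ c : ℝ, 0 < c ∧ ∀ i, ∀ w ∈ exponents (Φ i), c ≤ w.re := by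
    choose c hc hcΦ using fun i => (hΦ i).exists_pos_le
    obtain hN | hN := isEmpty_or_nonempty (Fin N)
    · exact ⟨1, one_pos, fun i => hN.elim i⟩
    · obtain ⟨i₀, h₀⟩ := Finite.exists_min c
      exact ⟨c i₀, hc i₀, fun i w hw => (h₀ i).trans (hcΦ i w hw)⟩
  have key : ∀ (d : ℕ) (i : Fin d → Fin N), ∀ w ∈ exponents (∏ k, Φ (i k)), (d : ℝ) * c ≤ w.re := by
    intro d
    induction d with
    | zero =>
      intro i w hw
      have : w = 0 := by
        by_contra hne
        refine hw ?_
        simp only [coeffAt, Finset.univ_eq_empty, Finset.prod_empty]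
        exact HahnSeries.coeff_single_of_ne fun h => hne (expo_injective h)
      simp [this]
    | succ d ih =>
      intro i w hw
      rw [Fin.prod_univ_succ] at hw
      obtain ⟨u, hu, v, hv, rfl⟩ := exponents_mul hw
      have h1 := hcΦ _ u hu
      have h2 := ih (fun k => i k.succ) v hv
      rw [Complex.add_re]
      push_cast
      linarith
  refine (Set.finite_Iic ⌈z.re / c⌉₊).subset fun d hd => ?_
  have hd' : coeffAt (taylorPart F Φ d) z ≠ 0 := hd
  simp only [coeffAt, taylorPart, HahnSeries.coeff_sum, HahnSeries.coeff_smul] at hd'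
  obtain ⟨i, -, hi⟩ := Finset.exists_ne_zero_of_sum_ne_zero hd'
  have h := key d i z fun h0 => hi (by
    have h0' : (∏ k, Φ (i k)).coeff (expo z) = 0 := h0
    rw [h0', smul_zero])
  have : (d : ℝ) ≤ z.re / c := (le_div_iff₀ hc).2 h
  exact_mod_cast this.trans (Nat.le_ceil _)

end Dulac

end

/-!
The exponents of the solution `φ` satisfy a recursion. Let `λ` be an exponent with `Re λ > Re ν`, and
let `P` be the sum of the terms of `φ` with exponents of real part less than `Re λ`. Expanding
`F(x, P, δ P, …)` at `φ`, where `F` vanishes, shows that its coefficient at `x^(λ + ν)` is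
`- ∑ A_j (λ + d/dt)^j c_λ`. This is nonzero as soon as `∑ A_j λ^j ≠ 0`, in particular when `Re λ` is
large. Since `F(x, P, δ P, …)` only has exponents that are sums of ones and of exponents of `P`, so is
`λ + ν` (`add_mem_closure_of_mem_exponents`). The series are expanded by means of Taylor polynomials
of high degree, whose derivatives are Taylor polynomials of the partial derivatives of `F`
(`pderiv_taylorSum`, `aeval_add_sub_mem_reGE`).

The exponent `ν` is itself a sum of ones and of exponents of `φ`, because `A_ℓ ≠ 0`. A combinatorial
argument then places all exponents of `φ` in a monoid generated by finitely many numbers of positive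
real part (`exists_finite_generators`), to which the number `1` and, if `ℓ < n`, the positive number
`(n - ℓ) s` are added. Finitely many numbers of positive real part lie in the monoid generated by
linearly independent numbers of positive real part (`exists_linearIndependent_generators`): a
rational simplicial cone is deformed, one negative coefficient at a time, until it contains all of
them.

For linearly independent generators `r_j` the exponent `∑ m_j r_j` determines `m`, and only finitely
many `m` give a bounded real part, so every power series without constant term comes from exactly
one Dulac series with exponents in the semigroup.
-/

noncomputable section

namespace Dulac

/-! ### Finitely generated monoids of exponents -/

/-- Every nonzero element of a monoid generated by finitely many numbers with positive real part is
a generator plus an element whose real part is smaller by a fixed amount, so that the monoid is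
locally finite. -/
theorem finite_closure_re_le {B : Set ℂ} (hB : B.Finite) (hpos : ∀ b ∈ B, 0 < b.re) (R : ℝ) :
    {z | z ∈ AddSubmonoid.closure B ∧ z.re ≤ R}.Finite := by
  obtain ⟨c, hc, hcB⟩ : ∃ c : ℝ, 0 < c ∧ ∀ b ∈ B, c ≤ b.re := by
    obtain rfl | hne := B.eq_empty_or_nonempty
    · exact ⟨1, one_pos, by simp⟩
    · obtain ⟨b, hb, hmin⟩ := Set.exists_min_image B Complex.re hB hne
      exact ⟨b.re, hpos b hb, hmin⟩
  have hnn : ∀ z ∈ AddSubmonoid.closure B, 0 ≤ z.re := fun z hz => by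
    induction hz using AddSubmonoid.closure_induction with
    | mem x hx => exact (hpos x hx).le
    | zero => simp
    | add x y _ _ hx hy => simpa using add_nonneg hx hy
  have main : ∀ k : ℕ, {z | z ∈ AddSubmonoid.closure B ∧ z.re ≤ k * c}.Finite := fun k => by
    induction k with
    | zero =>
      refine (Set.finite_singleton (0 : ℂ)).subset ?_
      rintro z ⟨hz, hk⟩
      induction hz using AddSubmonoid.closure_induction_left with
      | zero => rfl
      | add_left b hb y hy _ =>
        have h1 := hpos b hb
        have h2 := hnn y hy
        simp only [Complex.add_re, Nat.cast_zero, zero_mul] at hk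
        linarith
    | succ k ih =>
      refine ((Set.finite_singleton (0 : ℂ)).union (hB.image2 (· + ·) ih)).subset ?_
      rintro z ⟨hz, hk⟩
      induction hz using AddSubmonoid.closure_induction_left with
      | zero => exact Or.inl rfl
      | add_left b hb y hy _ =>
        have h1 := hcB b hb
        simp only [Complex.add_re, Nat.cast_succ] at hk
        exact Or.inr ⟨b, hb, y, ⟨hy, by linarith⟩, rfl⟩
  refine (main ⌈R / c⌉₊).subset fun z hz => ⟨hz.1, hz.2.trans ?_⟩
  exact (div_le_iff₀ hc).1 (Nat.le_ceil _)

/-- The differences `g - w` of positive real part, with `g` in a finitely generated monoid, lie in a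
finitely generated monoid: while `g` is built up generator by generator, the real part of `g - w`
becomes positive at one of finitely many elements. -/
theorem exists_finite_shift {B : Set ℂ} (hB : B.Finite) (hpos : ∀ b ∈ B, 0 < b.re) (w : ℂ) :
    ∃ Z : Set ℂ, Z.Finite ∧ (∀ z ∈ Z, 0 < z.re) ∧
      ∀ g ∈ AddSubmonoid.closure B, w.re < g.re → g - w ∈ AddSubmonoid.closure (B ∪ Z) := by
  obtain ⟨R, hR⟩ := (hB.image Complex.re).bddAbove
  refine ⟨(· - w) '' {h | (h ∈ AddSubmonoid.closure B ∧ h.re ≤ max (w.re + R) 0) ∧ w.re < h.re},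
    ?_, ?_, ?_⟩
  · exact ((finite_closure_re_le hB hpos _).subset fun _ h => h.1).image _
  · rintro _ ⟨h, hh, rfl⟩
    simpa using hh.2
  · intro g hg
    induction hg using AddSubmonoid.closure_induction_left with
    | zero =>
      exact fun h => AddSubmonoid.subset_closure
        (Or.inr ⟨0, ⟨⟨zero_mem _, le_max_right _ _⟩, h⟩, rfl⟩)
    | add_left b hb y hy ih =>
      intro h
      by_cases hyw : w.re < y.re
      · rw [add_sub_assoc]
        exact add_mem (AddSubmonoid.subset_closure (Or.inl hb)) (ih hyw)
      · refine AddSubmonoid.subset_closure (Or.inr ⟨b + y,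
          ⟨⟨add_mem (AddSubmonoid.subset_closure hb) hy, le_max_of_le_left ?_⟩, h⟩, rfl⟩)
        have h1 : b.re ≤ R := hR ⟨b, hb, rfl⟩
        rw [Complex.add_re]
        linarith

/-- If every large `λ ∈ E`, shifted by a fixed `ν`, is a sum of ones and of elements of `E` with
smaller real part, then `E` lies in a finitely generated monoid. The proof shows that `λ - ν` lies
in a fixed finitely generated monoid `S` for all large `λ ∈ E`. A sum `λ + ν = g + μ₁ + ⋯ + μ_k`
with large `μ_i ∈ E` and `g` a sum of the other summands reads
`λ - ν = (g + (k - 2) ν) + (μ₁ - ν) + ⋯ + (μ_k - ν)`. For `k ≥ 2` the first bracket is a sum of small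
generators; for `k = 0, 1` it is `g - 2 ν` or `g - ν`, has positive real part, and `S` is chosen to
contain all such elements. -/
theorem exists_finite_generators {E : Set ℂ} (hpos : ∀ z ∈ E, 0 < z.re)
    (hfin : ∀ N : ℝ, {z ∈ E | z.re ≤ N}.Finite) {ν : ℂ} {N : ℝ} (hN : ν.re ≤ N)
    (hν : ν ∈ AddSubmonoid.closure (insert 1 {μ ∈ E | μ.re ≤ N}))
    (hE : ∀ z ∈ E, N < z.re → z + ν ∈ AddSubmonoid.closure (insert 1 {μ ∈ E | μ.re < z.re})) :
    ∃ Z : Set ℂ, Z.Finite ∧ (∀ z ∈ Z, 0 < z.re) ∧ 1 ∈ Z ∧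
      ∀ z ∈ E, z ∈ AddSubmonoid.closure Z := by
  set B : Set ℂ := insert 1 {μ ∈ E | μ.re ≤ N} with hBdef
  have hB : B.Finite := (hfin N).insert 1
  have hBpos : ∀ b ∈ B, 0 < b.re := by
    rintro b (rfl | hb)
    · simp
    · exact hpos b hb.1
  obtain ⟨Z₁, hZ₁, hZ₁pos, h₁⟩ := exists_finite_shift hB hBpos ν
  obtain ⟨Z₂, hZ₂, hZ₂pos, h₂⟩ := exists_finite_shift hB hBpos (2 * ν)
  set Z : Set ℂ := B ∪ Z₁ ∪ Z₂ with hZdef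
  have hBS : AddSubmonoid.closure B ≤ AddSubmonoid.closure Z :=
    AddSubmonoid.closure_mono fun _ h => Or.inl (Or.inl h)
  have hS₁ : AddSubmonoid.closure (B ∪ Z₁) ≤ AddSubmonoid.closure Z :=
    AddSubmonoid.closure_mono fun _ h => Or.inl h
  have hS₂ : AddSubmonoid.closure (B ∪ Z₂) ≤ AddSubmonoid.closure Z :=
    AddSubmonoid.closure_mono fun _ h => h.elim (fun h => Or.inl (Or.inl h)) Or.inr
  have key : ∀ z ∈ E, N < z.re → z - ν ∈ AddSubmonoid.closure Z := by
    by_contra! ⟨z₀, hz₀, hz₀N, hz₀S⟩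
    obtain ⟨z, ⟨⟨hz, -⟩, hzN, hzS⟩, hmin⟩ := Set.exists_min_image
      {z | (z ∈ E ∧ z.re ≤ z₀.re) ∧ N < z.re ∧ z - ν ∉ AddSubmonoid.closure Z} Complex.re
      ((hfin z₀.re).subset fun _ h => h.1) ⟨z₀, ⟨hz₀, le_rfl⟩, hz₀N, hz₀S⟩
    have ih : ∀ μ ∈ E, N < μ.re → μ.re < z.re → μ - ν ∈ AddSubmonoid.closure Z := by
      intro μ hμ hμN hμz
      by_contra hμS
      by_cases hle : μ.re ≤ z₀.re
      · exact hμz.not_ge (hmin μ ⟨⟨hμ, hle⟩, hμN, hμS⟩)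
      · exact (hmin z₀ ⟨⟨hz₀, le_rfl⟩, hz₀N, hz₀S⟩).not_gt ((not_le.1 hle).trans hμz)
    have split : ∀ w ∈ AddSubmonoid.closure (insert 1 {μ ∈ E | μ.re < z.re}),
        w ∈ AddSubmonoid.closure B ∨
        (∃ g ∈ AddSubmonoid.closure B, ∃ μ, μ.re < z.re ∧ μ - ν ∈ AddSubmonoid.closure Z ∧
          w = g + μ) ∨ w - 2 * ν ∈ AddSubmonoid.closure Z := by
      intro w hw
      induction hw using AddSubmonoid.closure_induction with
      | mem x hx =>
        obtain rfl | ⟨hxE, hxz⟩ := hx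
        · exact Or.inl (AddSubmonoid.subset_closure (Or.inl rfl))
        · by_cases hxN : x.re ≤ N
          · exact Or.inl (AddSubmonoid.subset_closure (Or.inr ⟨hxE, hxN⟩))
          · exact Or.inr (Or.inl ⟨0, zero_mem _, x, hxz, ih x hxE (not_le.1 hxN) hxz,
              (zero_add x).symm⟩)
      | zero => exact Or.inl (zero_mem _)
      | add x y _ _ hx hy =>
        have hνS := hBS hν
        rcases hx with hx | ⟨g, hg, μ, hμz, hμ, rfl⟩ | hx <;>
        rcases hy with hy | ⟨g', hg', μ', hμz', hμ', rfl⟩ | hy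
        · exact Or.inl (add_mem hx hy)
        · exact Or.inr (Or.inl ⟨x + g', add_mem hx hg', μ', hμz', hμ', by ring⟩)
        · refine Or.inr (Or.inr ?_)
          convert add_mem (hBS hx) hy using 1
          ring
        · exact Or.inr (Or.inl ⟨g + y, add_mem hg hy, μ, hμz, hμ, by ring⟩)
        · refine Or.inr (Or.inr ?_)
          convert add_mem (add_mem (hBS hg) (hBS hg')) (add_mem hμ hμ') using 1
          ring
        · refine Or.inr (Or.inr ?_)
          convert add_mem (add_mem (hBS hg) hμ) (add_mem hνS hy) using 1
          ring
        · refine Or.inr (Or.inr ?_)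
          convert add_mem hx (hBS hy) using 1
          ring
        · refine Or.inr (Or.inr ?_)
          convert add_mem (add_mem (hBS hg') hμ') (add_mem hνS hx) using 1
          ring
        · refine Or.inr (Or.inr ?_)
          convert add_mem (add_mem hx hy) (add_mem hνS hνS) using 1
          ring
    refine hzS ?_
    rcases split _ (hE z hz hzN) with h | ⟨g, hg, μ, hμz, hμ, h⟩ | h
    · convert hS₂ (h₂ _ h ?_) using 1
      · ring
      · simp
        linarith
    · have hre := congrArg Complex.re h
      rw [Complex.add_re, Complex.add_re] at hre
      convert add_mem (hS₁ (h₁ g hg (by linarith))) hμ using 1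
      linear_combination h
    · convert h using 1
      ring
  refine ⟨Z, (hB.union hZ₁).union hZ₂, ?_, Or.inl (Or.inl (Or.inl rfl)), fun z hz => ?_⟩
  · rintro z ((h | h) | h)
    exacts [hBpos z h, hZ₁pos z h, hZ₂pos z h]
  · by_cases hzN : z.re ≤ N
    · exact AddSubmonoid.subset_closure (Or.inl (Or.inl (Or.inr ⟨hz, hzN⟩)))
    · convert add_mem (key z hz (not_le.1 hzN)) (hBS hν) using 1
      ring

/-! ### Linearly independent generators -/

/-- One rational coefficient `a j < 0` of a number `∑ a i • r i` of positive real part can be made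
nonnegative, with the others unchanged, by replacing `r i` by `r i - q i • r j` for suitable
rationals `q i ≥ 0`. -/
theorem exists_basis_change {κ : ℕ} {r : Fin κ → ℂ} (hr : LinearIndependent ℚ r)
    (hpos : ∀ i, 0 < (r i).re) {a : Fin κ → ℚ} (ha : 0 < (∑ i, a i • r i).re) {j : Fin κ}
    (hj : a j < 0) :
    ∃ r' : Fin κ → ℂ, LinearIndependent ℚ r' ∧ (∀ i, 0 < (r' i).re) ∧
      (∀ i, r i ∈ PointedCone.hull ℚ (Set.range r')) ∧
      ∃ c : ℚ, 0 ≤ c ∧ ∑ i, a i • r i = ∑ i, Function.update a j c i • r' i := by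
  classical
  set S : ℝ := ∑ i with 0 < a i, (a i : ℝ) * (r i).re with hS
  have hjS : -(a j : ℝ) * (r j).re < S := by
    have h1 : (∑ i, a i • r i).re = ∑ i, (a i : ℝ) * (r i).re := by
      simp [Complex.re_sum, Rat.smul_def]
    rw [h1, ← Finset.sum_filter_add_sum_filter_not Finset.univ (fun i => 0 < a i)] at ha
    have h2 : ∑ i with ¬ 0 < a i, (a i : ℝ) * (r i).re ≤ (a j : ℝ) * (r j).re := by
      rw [← Finset.add_sum_erase _ _ (a := j) (by simp [hj.le])]
      refine add_le_of_nonpos_right (Finset.sum_nonpos fun i hi => ?_)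
      have : a i ≤ 0 := by simpa using (Finset.mem_filter.1 (Finset.mem_of_mem_erase hi)).2
      exact mul_nonpos_of_nonpos_of_nonneg (by exact_mod_cast this) (hpos i).le
    linarith
  have hj' : (a j : ℝ) < 0 := by exact_mod_cast hj
  have hS0 : 0 < S := lt_trans (mul_pos (neg_pos.2 hj') (hpos j)) hjS
  -- With `q i = - a j * re (r i) / S` the new coefficient would be exactly zero; the strict
  -- inequality `hjS` leaves room for a rational `q i` that keeps `re (r i - q i • r j)` positive.
  have hq : ∀ i, ∃ q : ℚ, (r i).re * (-(a j : ℝ)) / S < q ∧ (q : ℝ) < (r i).re / (r j).re :=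
    fun i => exists_rat_btwn <| by
      rw [div_lt_div_iff₀ hS0 (hpos j), mul_assoc]
      exact mul_lt_mul_of_pos_left hjS (hpos i)
  choose q hq₁ hq₂ using hq
  have hq₀ : ∀ i, 0 < q i := fun i => by
    have : (0 : ℝ) < q i :=
      lt_trans (div_pos (mul_pos (hpos i) (neg_pos.2 hj')) hS0) (hq₁ i)
    exact_mod_cast this
  set p : Fin κ → ℚ := fun i => if 0 < a i then q i else 0 with hp
  have hp0 : ∀ i, 0 ≤ p i := fun i => by
    simp only [hp]
    split_ifs
    exacts [(hq₀ i).le, le_rfl]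
  have hpj : p j = 0 := if_neg hj.not_gt
  set r' : Fin κ → ℂ := r + ((-p) · • r j) with hr'
  have hr'j : r' j = r j := by simp [hr', hpj]
  have hrr' : ∀ i, r i = r' i + p i • r' j := fun i => by
    rw [hr'j]
    simp [hr']
  refine ⟨r', (linearIndependent_add_smul_iff (by simp [hpj])).2 hr, fun i => ?_, fun i => ?_,
    a j + ∑ i, a i * p i, ?_, ?_⟩
  · have : (r' i).re = (r i).re - p i * (r j).re := by
      simp [hr', Rat.smul_def, sub_eq_add_neg]
    rw [this, sub_pos]
    simp only [hp]
    split_ifs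
    · exact (lt_div_iff₀ (hpos j)).1 (hq₂ i)
    · simpa using hpos i
  · rw [hrr' i]
    exact add_mem (Submodule.subset_span ⟨i, rfl⟩)
      (Submodule.smul_mem _ (⟨p i, hp0 i⟩ : {c : ℚ // 0 ≤ c}) (Submodule.subset_span ⟨j, rfl⟩))
  · have h1 : ∑ i, a i * p i = ∑ i with 0 < a i, a i * q i := by
      rw [Finset.sum_filter]
      exact Finset.sum_congr rfl fun i _ => by simp only [hp]; split_ifs <;> simp
    have h2 : -(a j : ℝ) ≤ ∑ i with 0 < a i, (a i : ℝ) * q i := by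
      calc -(a j : ℝ) = (∑ i with 0 < a i, (a i : ℝ) * (r i).re) * (-(a j : ℝ)) / S := by
            rw [← hS]
            field_simp
        _ = ∑ i with 0 < a i, (a i : ℝ) * ((r i).re * (-(a j : ℝ)) / S) := by
            rw [Finset.sum_mul, Finset.sum_div]
            exact Finset.sum_congr rfl fun i _ => by ring
        _ ≤ _ := Finset.sum_le_sum fun i hi => mul_le_mul_of_nonneg_left (hq₁ i).le (by
            exact_mod_cast (Finset.mem_filter.1 hi).2.le)
    rw [h1]
    have h3 : -a j ≤ ∑ i with 0 < a i, a i * q i := by exact_mod_cast h2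
    linarith
  · have h1 : ∑ i, a i • r i = ∑ i, a i • r' i + (∑ i, a i * p i) • r' j := by
      rw [Finset.sum_smul, ← Finset.sum_add_distrib]
      exact Finset.sum_congr rfl fun i _ => by rw [hrr' i, smul_add, smul_smul]
    rw [h1, ← Finset.add_sum_erase _ _ (Finset.mem_univ j),
      ← Finset.add_sum_erase _ (fun i => Function.update a j _ i • r' i) (Finset.mem_univ j),
      Function.update_self, add_smul, add_right_comm]
    congr 1
    exact Finset.sum_congr rfl fun i hi => by
      rw [Function.update_of_ne (Finset.ne_of_mem_erase hi)]

/-- A number `∑ a i • r i` of positive real part can be added to a simplicial cone without increasing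
the number of edges; the induction is on the number `k` of negative coefficients. -/
theorem exists_cone_of_sum {κ : ℕ} (k : ℕ) {r : Fin κ → ℂ} (hr : LinearIndependent ℚ r)
    (hpos : ∀ i, 0 < (r i).re) {a : Fin κ → ℚ} (ha : 0 < (∑ i, a i • r i).re)
    (hk : (Finset.univ.filter fun i => a i < 0).card ≤ k) :
    ∃ r' : Fin κ → ℂ, LinearIndependent ℚ r' ∧ (∀ i, 0 < (r' i).re) ∧
      (∀ i, r i ∈ PointedCone.hull ℚ (Set.range r')) ∧
      ∑ i, a i • r i ∈ PointedCone.hull ℚ (Set.range r') := by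
  induction k generalizing r a with
  | zero =>
    refine ⟨r, hr, hpos, fun i => Submodule.subset_span ⟨i, rfl⟩, sum_mem fun i _ => ?_⟩
    have hi : 0 ≤ a i := by
      rw [Nat.le_zero, Finset.card_eq_zero, Finset.filter_eq_empty_iff] at hk
      exact not_lt.1 (hk (Finset.mem_univ i))
    exact Submodule.smul_mem _ (⟨a i, hi⟩ : {c : ℚ // 0 ≤ c}) (Submodule.subset_span ⟨i, rfl⟩)
  | succ k ih =>
    by_cases hneg : ∃ j, a j < 0
    · obtain ⟨j, hj⟩ := hneg
      obtain ⟨r₁, hr₁, hpos₁, hcone₁, c, hc, hsum⟩ := exists_basis_change hr hpos ha hj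
      rw [hsum] at ha ⊢
      obtain ⟨r₂, hr₂, hpos₂, hcone₂, hz⟩ := ih hr₁ hpos₁ ha (by
        have hlt : (Finset.univ.filter fun i => Function.update a j c i < 0).card <
            (Finset.univ.filter fun i => a i < 0).card := by
          refine Finset.card_lt_card ⟨fun i hi => ?_, fun h => ?_⟩
          · have hi' := (Finset.mem_filter.1 hi).2
            obtain rfl | hij := eq_or_ne i j
            · simpa using hj
            · rw [Function.update_of_ne hij] at hi'
              simpa using hi'
          · have := (Finset.mem_filter.1 (h (Finset.mem_filter.2 ⟨Finset.mem_univ j, hj⟩))).2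
            rw [Function.update_self] at this
            exact this.not_ge hc
        omega)
      refine ⟨r₂, hr₂, hpos₂, fun i => ?_, hz⟩
      exact (Submodule.span_le.2 (Set.range_subset_iff.2 hcone₂)) (hcone₁ i)
    · exact ih hr hpos ha (by
        rw [Finset.card_eq_zero.2 (Finset.filter_eq_empty_iff.2 fun i _ h => hneg ⟨i, h⟩)]
        exact Nat.zero_le _)

/-- Finitely many numbers with positive real part lie in a simplicial rational cone whose edges have
positive real part. -/
theorem exists_simplicial_cone {Z : Set ℂ} (hZ : Z.Finite) (hpos : ∀ z ∈ Z, 0 < z.re) :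
    ∃ (κ : ℕ) (r : Fin κ → ℂ), LinearIndependent ℚ r ∧ (∀ j, 0 < (r j).re) ∧
      Z ⊆ PointedCone.hull ℚ (Set.range r) := by
  induction Z, hZ using Set.Finite.induction_on with
  | empty => exact ⟨0, Fin.elim0, linearIndependent_empty_type, fun j => j.elim0, by simp⟩
  | @insert z Z _ _ ih =>
    obtain ⟨κ, r, hr, hrpos, hZr⟩ := ih fun w hw => hpos w (Or.inr hw)
    have hz := hpos z (Or.inl rfl)
    by_cases hspan : z ∈ Submodule.span ℚ (Set.range r)
    · obtain ⟨a, rfl⟩ := (Submodule.mem_span_range_iff_exists_fun ℚ).1 hspan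
      obtain ⟨r', hr', hpos', hcone, hmem⟩ := exists_cone_of_sum _ hr hrpos hz le_rfl
      exact ⟨κ, r', hr', hpos', Set.insert_subset hmem
        (hZr.trans (Submodule.span_le.2 (Set.range_subset_iff.2 hcone)))⟩
    · refine ⟨κ + 1, Fin.cons z r, linearIndependent_finCons.2 ⟨hr, hspan⟩, ?_, ?_⟩
      · exact Fin.cases hz hrpos
      · refine Set.insert_subset (Submodule.subset_span ⟨0, rfl⟩) (hZr.trans ?_)
        exact Submodule.span_mono (Set.range_subset_iff.2 fun i => ⟨i.succ, rfl⟩)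

/-- Finitely many numbers with positive real part lie in the monoid generated by linearly
independent numbers with positive real part: the edges of a simplicial rational cone, divided by a
common denominator. -/
theorem exists_linearIndependent_generators {Z : Set ℂ} (hZ : Z.Finite)
    (hpos : ∀ z ∈ Z, 0 < z.re) :
    ∃ (κ : ℕ) (r : Fin κ → ℂ), LinearIndependent ℤ r ∧ (∀ j, 0 < (r j).re) ∧
      Z ⊆ AddSubmonoid.closure (Set.range r) := by
  obtain ⟨κ, r, hr, hrpos, hZr⟩ := exists_simplicial_cone hZ hpos
  obtain ⟨D, hD, hDZ⟩ : ∃ D : ℕ, D ≠ 0 ∧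
      ∀ z ∈ Z, (D : ℂ) * z ∈ AddSubmonoid.closure (Set.range r) := by
    clear hpos
    induction Z, hZ using Set.Finite.induction_on with
    | empty => exact ⟨1, one_ne_zero, by simp⟩
    | @insert z Z _ _ ih =>
      obtain ⟨D, hD, hDZ⟩ := ih ((Set.subset_insert _ _).trans hZr)
      obtain ⟨a, rfl⟩ := (Submodule.mem_span_range_iff_exists_fun _).1 (hZr (Or.inl rfl))
      refine ⟨D * ∏ j, (a j : ℚ).den,
        mul_ne_zero hD (Finset.prod_ne_zero_iff.2 fun j _ => (a j : ℚ).den_nz), ?_⟩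
      rintro w (rfl | hw)
      · rw [Finset.mul_sum]
        refine sum_mem fun j _ => ?_
        have hj : ((D * ∏ j, (a j : ℚ).den : ℕ) : ℂ) * (a j • r j) =
            (D * (∏ i ∈ Finset.univ.erase j, (a i : ℚ).den) * (a j : ℚ).num.toNat : ℕ) • r j := by
          have h1 : ((a j : ℚ) : ℂ) * ((a j : ℚ).den : ℂ) = ((a j : ℚ).num.toNat : ℂ) := by
            have h2 : (((a j : ℚ).num.toNat : ℤ) : ℚ) = (a j : ℚ).num := by
              rw [Int.toNat_of_nonneg (Rat.num_nonneg.2 (a j).2)]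
            have h3 : (a j : ℚ) * ((a j : ℚ).den : ℚ) = ((a j : ℚ).num.toNat : ℚ) := by
              rw [Rat.mul_den_eq_num, ← h2, Int.cast_natCast]
            exact_mod_cast congrArg (Rat.cast : ℚ → ℂ) h3
          rw [← Finset.mul_prod_erase _ _ (Finset.mem_univ j), nsmul_eq_mul]
          change _ * ((a j : ℚ) • r j) = _
          rw [Rat.smul_def]
          push_cast
          rw [← h1]
          ring
        rw [hj]
        exact nsmul_mem (AddSubmonoid.subset_closure (Set.mem_range_self j)) _
      · rw [mul_comm D, Nat.cast_mul, mul_assoc, ← nsmul_eq_mul]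
        exact nsmul_mem (hDZ w hw) _
  have hD' : (D : ℂ) ≠ 0 := Nat.cast_ne_zero.2 hD
  refine ⟨κ, fun j => (D : ℂ)⁻¹ * r j, ?_, fun j => ?_, fun z hz => ?_⟩
  · refine LinearIndependent.restrict_scalars (K := ℚ) (fun m n h => by simpa using h) ?_
    exact hr.map' (LinearMap.mulLeft ℚ (D : ℂ)⁻¹)
      (LinearMap.ker_eq_bot.2 (mul_right_injective₀ (inv_ne_zero hD')))
  · have : ((D : ℂ)⁻¹ * r j).re = (D : ℝ)⁻¹ * (r j).re := by
      rw [← Complex.ofReal_natCast, ← Complex.ofReal_inv, Complex.re_ofReal_mul]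
    rw [this]
    exact mul_pos (inv_pos.2 (Nat.cast_pos.2 (Nat.pos_of_ne_zero hD))) (hrpos j)
  · have h := AddSubmonoid.mem_map_of_mem (AddMonoidHom.mulLeft (D : ℂ)⁻¹) (hDZ z hz)
    rw [AddMonoidHom.map_mclosure, ← Set.range_comp] at h
    simpa [hD', Function.comp_def] using h

/-! ### Taylor polynomials and their partial derivatives -/

/-- The homogeneous part of degree `d` of the Taylor expansion of `F` at the origin, as a polynomial:
`taylorPart F Φ d` is its value at `Φ`. -/
def taylorPoly {N : ℕ} (F : (Fin N → ℂ) → ℂ) (d : ℕ) : MvPolynomial (Fin N) ℂ :=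
  ∑ i : Fin d → Fin N,
    ((d.factorial : ℂ)⁻¹ * iteratedFDeriv ℂ d F 0 (fun k => Pi.single (i k) 1)) •
      ∏ k, MvPolynomial.X (i k)

theorem aeval_taylorPoly {N : ℕ} (F : (Fin N → ℂ) → ℂ) (Φ : Fin N → FormalSeries) (d : ℕ) :
    MvPolynomial.aeval Φ (taylorPoly F d) = taylorPart F Φ d := by
  simp [taylorPoly, taylorPart, map_sum, map_prod]

theorem pderiv_prod_X {N d : ℕ} (a : Fin N) (i : Fin (d + 1) → Fin N) :
    MvPolynomial.pderiv a (∏ k, MvPolynomial.X (i k) : MvPolynomial (Fin N) ℂ) =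
      ∑ k, if i k = a then ∏ k', MvPolynomial.X (k.removeNth i k') else 0 := by
  induction d with
  | zero =>
    rw [Fin.sum_univ_succ, Fin.prod_univ_succ]
    simp [MvPolynomial.pderiv_X, Pi.single_apply]
  | succ d ih =>
    have h : ∀ k : Fin (d + 1),
        ∏ k', (MvPolynomial.X (k.succ.removeNth i k') : MvPolynomial (Fin N) ℂ) =
          MvPolynomial.X (i 0) * ∏ k', MvPolynomial.X (k.removeNth (fun m => i m.succ) k') :=
      fun k => by simp [Fin.prod_univ_succ, Fin.removeNth]
    rw [Fin.prod_univ_succ, MvPolynomial.pderiv_mul, ih]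
    conv_rhs => rw [Fin.sum_univ_succ]
    simp only [h, MvPolynomial.pderiv_X, Pi.single_apply, Finset.mul_sum, mul_ite, mul_zero,
      ite_mul, one_mul, zero_mul]
    rfl

theorem pderiv_taylorPoly_zero {N : ℕ} (F : (Fin N → ℂ) → ℂ) (a : Fin N) :
    MvPolynomial.pderiv a (taylorPoly F 0) = 0 := by
  simp [taylorPoly]

theorem iteratedFDeriv_insertNth {N : ℕ} {F : (Fin N → ℂ) → ℂ} (hF : AnalyticAt ℂ F 0) {d : ℕ}
    (v : Fin N → ℂ) (m : Fin d → Fin N → ℂ) (k : Fin (d + 1)) :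
    iteratedFDeriv ℂ (d + 1) F 0 (k.insertNth v m) =
      iteratedFDeriv ℂ d (fun p => fderiv ℂ F p v) 0 m := by
  have h1 : ∀ k : Fin (d + 1), iteratedFDeriv ℂ (d + 1) F 0 (k.insertNth v m) =
      iteratedFDeriv ℂ (d + 1) F 0 (Fin.cons v m) := fun k => by
    rw [← Fin.insertNth_comp_cycleRange_symm k, ContDiffAt.iteratedFDeriv_comp_perm hF.contDiffAt]
  have h2 : ContDiffAt ℂ d (fderiv ℂ F) 0 := hF.fderiv.contDiffAt
  have h3 := (ContinuousLinearMap.apply ℂ ℂ v).iteratedFDeriv_comp_left h2 le_rfl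
  rw [h1, ← h1 (Fin.last d), iteratedFDeriv_succ_apply_right, Fin.insertNth_last', Fin.init_snoc,
    Fin.snoc_last]
  exact (congrArg (fun T => T m) h3).symm

/-- Each of the `d + 1` factors of a monomial of degree `d + 1` contributes the same amount to the
derivative, because iterated derivatives of an analytic function are symmetric. -/
theorem pderiv_taylorPoly_succ {N : ℕ} {F : (Fin N → ℂ) → ℂ} (hF : AnalyticAt ℂ F 0) (a : Fin N)
    (d : ℕ) :
    MvPolynomial.pderiv a (taylorPoly F (d + 1)) =
      taylorPoly (fun p => fderiv ℂ F p (Pi.single a 1)) d := by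
  have h : ∀ k : Fin (d + 1), ∑ i : Fin (d + 1) → Fin N,
      (((d + 1).factorial : ℂ)⁻¹ * iteratedFDeriv ℂ (d + 1) F 0 (fun k => Pi.single (i k) 1)) •
        (if i k = a then ∏ k', MvPolynomial.X (k.removeNth i k') else 0 :
          MvPolynomial (Fin N) ℂ) =
      ((d + 1 : ℕ) : ℂ)⁻¹ • taylorPoly (fun p => fderiv ℂ F p (Pi.single a 1)) d := fun k => by
    rw [← (Fin.insertNthEquiv (fun _ => Fin N) k).sum_comp, Fintype.sum_prod_type,
      Finset.sum_eq_single a (fun b _ hb => by simp [hb]) (by simp), taylorPoly, Finset.smul_sum]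
    refine Finset.sum_congr rfl fun i _ => ?_
    have hi : (fun m => Pi.single ((k.insertNth a i : Fin (d + 1) → Fin N) m) (1 : ℂ)) =
        (k.insertNth (Pi.single a (1 : ℂ)) fun m => Pi.single (i m) (1 : ℂ) :
          Fin (d + 1) → Fin N → ℂ) := by
      funext m
      refine Fin.succAboveCases k ?_ (fun m => ?_) m <;> simp
    simp only [Fin.insertNthEquiv_apply, Fin.insertNth_apply_same, if_true,
      Fin.removeNth, Fin.insertNth_apply_succAbove, hi, iteratedFDeriv_insertNth hF, smul_smul,
      ← mul_assoc, Nat.factorial_succ, Nat.cast_mul, mul_inv]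
  simp only [taylorPoly, map_sum, Derivation.map_smul, pderiv_prod_X, Finset.smul_sum]
  rw [Finset.sum_comm]
  simp only [h]
  rw [Finset.sum_const, Finset.card_univ, Fintype.card_fin, ← Nat.cast_smul_eq_nsmul ℂ, smul_smul,
    mul_inv_cancel₀ (Nat.cast_ne_zero.2 d.succ_ne_zero), one_smul, taylorPoly]

/-! ### Formal series with restricted exponents -/

/-- The algebra of formal series whose exponents all lie in the monoid `M`. -/
def seriesAlgebra (M : AddSubmonoid ℂ) : Subalgebra ℂ FormalSeries where
  carrier := {φ | exponents φ ⊆ M}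
  add_mem' h h' _ hz := (exponents_add hz).elim (h ·) (h' ·)
  mul_mem' h h' z hz := by
    obtain ⟨u, hu, v, hv, rfl⟩ := exponents_mul hz
    exact M.add_mem (h hu) (h' hv)
  algebraMap_mem' c z hz := by
    have : z = 0 := by
      by_contra hne
      exact hz (HahnSeries.coeff_single_of_ne fun h => hne (expo_injective h))
    exact this ▸ M.zero_mem

/-- The series whose exponents all have real part at least `ρ`. -/
def reGE (ρ : ℝ) : AddSubgroup FormalSeries where
  carrier := {φ | ∀ z ∈ exponents φ, ρ ≤ z.re}
  zero_mem' := by simp [exponents, coeffAt]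
  add_mem' h h' _ hz := (exponents_add hz).elim (h _) (h' _)
  neg_mem' h z hz := h z (by rwa [exponents_neg] at hz)

theorem reGE_mono {ρ σ : ℝ} (h : σ ≤ ρ) : reGE ρ ≤ reGE σ := fun _ hφ z hz => h.trans (hφ z hz)

theorem mul_mem_reGE {ρ σ : ℝ} {φ ψ : FormalSeries} (hφ : φ ∈ reGE ρ) (hψ : ψ ∈ reGE σ) :
    φ * ψ ∈ reGE (ρ + σ) := fun z hz => by
  obtain ⟨u, hu, v, hv, rfl⟩ := exponents_mul hz
  exact add_le_add (hφ u hu) (hψ v hv)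

/-- The numbers of nonnegative real part. -/
def reNonneg : AddSubmonoid ℂ where
  carrier := {z | 0 ≤ z.re}
  zero_mem' := show (0 : ℝ) ≤ (0 : ℂ).re from le_rfl
  add_mem' {a b} (ha : 0 ≤ a.re) (hb : 0 ≤ b.re) := show 0 ≤ (a + b).re from add_nonneg ha hb

theorem aeval_mem_seriesAlgebra {N : ℕ} {M : AddSubmonoid ℂ} {Φ : Fin N → FormalSeries}
    (hΦ : ∀ i, exponents (Φ i) ⊆ M) (p : MvPolynomial (Fin N) ℂ) :
    exponents (MvPolynomial.aeval Φ p) ⊆ M := by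
  have h : MvPolynomial.aeval Φ p ∈ Algebra.adjoin ℂ (Set.range Φ) :=
    Algebra.adjoin_range_eq_range_aeval ℂ Φ ▸ ⟨p, rfl⟩
  exact Algebra.adjoin_le (S := seriesAlgebra M) (Set.range_subset_iff.2 hΦ) h

/-- How the remainder of the first order Taylor expansion of a polynomial changes when the polynomial
is multiplied by a variable. -/
theorem taylor_remainder_mul_X {A : Type*} [CommRing A] [Algebra ℂ A] {N : ℕ} (Φ Ψ : Fin N → A)
    (p : MvPolynomial (Fin N) ℂ) (i : Fin N) :
    MvPolynomial.aeval (Φ + Ψ) (p * MvPolynomial.X i) -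
      MvPolynomial.aeval Φ (p * MvPolynomial.X i) -
      ∑ j, MvPolynomial.aeval Φ (MvPolynomial.pderiv j (p * MvPolynomial.X i)) * Ψ j =
    (MvPolynomial.aeval (Φ + Ψ) p - MvPolynomial.aeval Φ p -
      ∑ j, MvPolynomial.aeval Φ (MvPolynomial.pderiv j p) * Ψ j) * (Φ i + Ψ i) +
    (∑ j, MvPolynomial.aeval Φ (MvPolynomial.pderiv j p) * Ψ j) * Ψ i := by
  have h : ∑ j, MvPolynomial.aeval Φ (MvPolynomial.pderiv j (p * MvPolynomial.X i)) * Ψ j =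
      (∑ j, MvPolynomial.aeval Φ (MvPolynomial.pderiv j p) * Ψ j) * Φ i +
        MvPolynomial.aeval Φ p * Ψ i := by
    simp only [MvPolynomial.pderiv_mul, MvPolynomial.pderiv_X, map_add, map_mul,
      MvPolynomial.aeval_X, add_mul, Finset.sum_add_distrib, Finset.sum_mul]
    congr 1
    · exact Finset.sum_congr rfl fun j _ => by ring
    · rw [Finset.sum_eq_single i (fun j _ hj => by simp [hj.symm]) (by simp)]
      simp
  rw [h]
  simp only [map_mul, MvPolynomial.aeval_X, Pi.add_apply]
  ring

/-- Taylor expansion to first order: a change of the arguments by series of real order at least `ρ`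
changes a polynomial by its differential up to terms of real order at least `2 ρ`. -/
theorem aeval_add_sub_mem_reGE {N : ℕ} {ρ : ℝ} (hρ : 0 ≤ ρ) {Φ Ψ : Fin N → FormalSeries}
    (hΦ : ∀ i, Φ i ∈ reGE 0) (hΨ : ∀ i, Ψ i ∈ reGE ρ) (p : MvPolynomial (Fin N) ℂ) :
    MvPolynomial.aeval (Φ + Ψ) p - MvPolynomial.aeval Φ p -
      ∑ i, MvPolynomial.aeval Φ (MvPolynomial.pderiv i p) * Ψ i ∈ reGE (2 * ρ) := by
  have hev : ∀ q : MvPolynomial (Fin N) ℂ, MvPolynomial.aeval Φ q ∈ reGE 0 :=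
    fun q _ hz => aeval_mem_seriesAlgebra (M := reNonneg) (fun i _ h => hΦ i _ h) q hz
  have hlin : ∀ q : MvPolynomial (Fin N) ℂ,
      ∑ i, MvPolynomial.aeval Φ (MvPolynomial.pderiv i q) * Ψ i ∈ reGE ρ := fun q =>
    sum_mem fun i _ => by simpa using mul_mem_reGE (hev _) (hΨ i)
  induction p using MvPolynomial.induction_on with
  | C c => simp
  | add p q hp hq =>
    convert add_mem hp hq using 1
    simp only [map_add, add_mul, Finset.sum_add_distrib]
    ring
  | mul_X p i hp =>
    have h1 := mul_mem_reGE hp (add_mem (hΦ i) (reGE_mono hρ (hΨ i)))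
    have h2 := mul_mem_reGE (hlin p) (hΨ i)
    rw [add_zero] at h1
    rw [← two_mul] at h2
    rw [taylor_remainder_mul_X]
    exact add_mem h1 h2

/-! ### Coefficients of the substituted Taylor series -/

/-- The part of degree less than `D` of the Taylor expansion of `F` at the origin. -/
def taylorSum {N : ℕ} (F : (Fin N → ℂ) → ℂ) (D : ℕ) : MvPolynomial (Fin N) ℂ :=
  ∑ d ∈ Finset.range D, taylorPoly F d

theorem pderiv_taylorSum {N : ℕ} {F : (Fin N → ℂ) → ℂ} (hF : AnalyticAt ℂ F 0) (a : Fin N)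
    (D : ℕ) :
    MvPolynomial.pderiv a (taylorSum F (D + 1)) =
      taylorSum (fun p => fderiv ℂ F p (Pi.single a 1)) D := by
  simp [taylorSum, Finset.sum_range_succ', pderiv_taylorPoly_succ hF, pderiv_taylorPoly_zero]

theorem prod_mem_reGE {N : ℕ} {Φ : Fin N → FormalSeries} {c : ℝ} (hΦ : ∀ i, Φ i ∈ reGE c) {d : ℕ}
    (i : Fin d → Fin N) : ∏ k, Φ (i k) ∈ reGE (d * c) := by
  induction d with
  | zero =>
    intro z hz
    have := (seriesAlgebra reNonneg).one_mem (by simpa using hz : z ∈ exponents 1)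
    simp only [Nat.cast_zero, zero_mul]
    exact this
  | succ d ih =>
    rw [Fin.prod_univ_succ]
    convert mul_mem_reGE (hΦ (i 0)) (ih fun k => i k.succ) using 2
    push_cast
    ring

theorem taylorPart_mem_reGE {N : ℕ} (F : (Fin N → ℂ) → ℂ) {Φ : Fin N → FormalSeries} {c : ℝ}
    (hΦ : ∀ i, Φ i ∈ reGE c) (d : ℕ) : taylorPart F Φ d ∈ reGE (d * c) :=
  sum_mem fun i _ z hz => prod_mem_reGE hΦ i z fun h => hz (by
    have h' : (∏ k, Φ (i k)).coeff (expo z) = 0 := h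
    simp [coeffAt, h'])

/-- Taylor polynomials of high degree have the same low order coefficients as the full series. -/
theorem coeffAt_aeval_taylorSum {N : ℕ} (F : (Fin N → ℂ) → ℂ) {Φ : Fin N → FormalSeries} {c : ℝ}
    (hc : 0 < c) (hΦ : ∀ i, Φ i ∈ reGE c) {D : ℕ} {z : ℂ} (hz : z.re < D * c) :
    coeffAt (MvPolynomial.aeval Φ (taylorSum F D)) z = substCoeff F Φ z := by
  rw [substCoeff, finsum_eq_sum_of_support_subset (s := Finset.range D)]
  · simp [taylorSum, coeffAt, map_sum, aeval_taylorPoly, HahnSeries.coeff_sum]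
  · intro d hd
    have h := taylorPart_mem_reGE F hΦ d z hd
    have h' : (d : ℝ) < D := lt_of_mul_lt_mul_right (h.trans_lt hz) hc.le
    simpa using h'

theorem coeffAt_mul_of_unique {U V : FormalSeries} {u v : ℂ}
    (h : ∀ u' ∈ exponents U, ∀ v' ∈ exponents V, u' + v' = u + v → u' = u) :
    coeffAt (U * V) (u + v) = coeffAt U u * coeffAt V v := by
  rw [coeffAt, HahnSeries.coeff_mul]
  refine Finset.sum_eq_single (expo u, expo v) ?_ ?_
  · rintro ⟨a, b⟩ hab hne
    obtain ⟨ha, hb, hsum⟩ := Finset.mem_antidiagonal.1 hab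
    obtain ⟨u', rfl⟩ := exists_expo a
    obtain ⟨v', rfl⟩ := exists_expo b
    have hsum' : u' + v' = u + v := expo_injective hsum
    obtain rfl := h u' ha v' hb hsum'
    obtain rfl := add_left_cancel hsum'
    exact absurd rfl hne
  · intro hnot
    by_contra hne
    exact hnot (Finset.mem_antidiagonal.2
      ⟨left_ne_zero_of_mul hne, right_ne_zero_of_mul hne, (expo_add u v).symm⟩)

theorem coeffAt_aeval_add {N : ℕ} {ρ : ℝ} (hρ : 0 ≤ ρ) {Φ Ψ : Fin N → FormalSeries}
    (hΦ : ∀ i, Φ i ∈ reGE 0) (hΨ : ∀ i, Ψ i ∈ reGE ρ) (p : MvPolynomial (Fin N) ℂ) {w : ℂ}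
    (hw : w.re < 2 * ρ) :
    coeffAt (MvPolynomial.aeval (Φ + Ψ) p) w = coeffAt (MvPolynomial.aeval Φ p) w +
      ∑ i, coeffAt (MvPolynomial.aeval Φ (MvPolynomial.pderiv i p) * Ψ i) w := by
  have h : coeffAt (MvPolynomial.aeval (Φ + Ψ) p - MvPolynomial.aeval Φ p -
      ∑ i, MvPolynomial.aeval Φ (MvPolynomial.pderiv i p) * Ψ i) w = 0 := by
    by_contra hne
    exact (aeval_add_sub_mem_reGE hρ hΦ hΨ p w hne).not_gt hw
  simp only [coeffAt, HahnSeries.coeff_sub, HahnSeries.coeff_sum] at h ⊢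
  rw [sub_sub, sub_eq_zero] at h
  exact h

/-! ### The derivation on a single coefficient -/

/-- The action `λ + d/dt` of `δ` on the coefficient of `x^λ`. -/
def deltaCoeff (z : ℂ) (c : Polynomial ℂ) : Polynomial ℂ :=
  Polynomial.C z * c + Polynomial.derivative c

theorem coeffAt_iterate_delta (j : ℕ) (φ : FormalSeries) (z : ℂ) :
    coeffAt (delta^[j] φ) z = (deltaCoeff z)^[j] (coeffAt φ z) := by
  induction j with
  | zero => rfl
  | succ j ih =>
    rw [Function.iterate_succ_apply', Function.iterate_succ_apply', ← ih]
    rfl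

theorem iterate_deltaCoeff_zero (z : ℂ) (j : ℕ) : (deltaCoeff z)^[j] 0 = 0 :=
  Function.iterate_fixed (by simp [deltaCoeff]) j

theorem coeff_natDegree_iterate_deltaCoeff (z : ℂ) (c : Polynomial ℂ) (j : ℕ) :
    ((deltaCoeff z)^[j] c).natDegree ≤ c.natDegree ∧
      ((deltaCoeff z)^[j] c).coeff c.natDegree = z ^ j * c.leadingCoeff := by
  induction j with
  | zero => simp
  | succ j ih =>
    rw [Function.iterate_succ_apply']
    refine ⟨Polynomial.natDegree_add_le_of_degree_le
      ((Polynomial.natDegree_C_mul_le _ _).trans ih.1)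
      ((Polynomial.natDegree_derivative_le _).trans ((Nat.sub_le _ _).trans ih.1)), ?_⟩
    rw [deltaCoeff, Polynomial.coeff_add, Polynomial.coeff_C_mul, ih.2,
      Polynomial.coeff_derivative, Polynomial.coeff_eq_zero_of_natDegree_lt (by omega)]
    ring

/-- The operator `∑ A_j (λ + d/dt)^j` on `ℂ[t]` multiplies leading coefficients by `∑ A_j λ^j`, so
it is injective unless `λ` is a root. -/
theorem sum_iterate_deltaCoeff_ne_zero {n : ℕ} {A : Fin n → ℂ} {z : ℂ}
    (hz : ∑ j, A j * z ^ (j : ℕ) ≠ 0) {c : Polynomial ℂ} (hc : c ≠ 0) :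
    ∑ j, Polynomial.C (A j) * (deltaCoeff z)^[j] c ≠ 0 := by
  intro h
  have h1 := congrArg (fun p => Polynomial.coeff p c.natDegree) h
  simp only [Polynomial.finsetSum_coeff, Polynomial.coeff_C_mul,
    (coeff_natDegree_iterate_deltaCoeff z c _).2, ← mul_assoc, ← Finset.sum_mul,
    Polynomial.coeff_zero] at h1
  exact mul_ne_zero hz (Polynomial.leadingCoeff_ne_zero.2 hc) h1

/-! ### Exponents of a formal solution -/

/-- The part of a formal series with exponents of real part less than `ρ`. -/
def truncRe (ρ : ℝ) (φ : FormalSeries) : FormalSeries where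
  coeff e := if (ofLex e).1 < ρ then φ.coeff e else 0
  isPWO_support' := φ.isPWO_support.mono fun e he h => he (by simp [h])

theorem coeffAt_truncRe (ρ : ℝ) (φ : FormalSeries) (z : ℂ) :
    coeffAt (truncRe ρ φ) z = if z.re < ρ then coeffAt φ z else 0 := rfl

theorem exponents_truncRe (ρ : ℝ) (φ : FormalSeries) :
    exponents (truncRe ρ φ) = {z ∈ exponents φ | z.re < ρ} := by
  ext z
  simp only [exponents, Set.mem_ofPred_eq, coeffAt_truncRe]
  split_ifs with h <;> simp [h]

theorem jet_zero (n : ℕ) (φ : FormalSeries) : jet n φ 0 = varX := rfl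

theorem jet_succ (n : ℕ) (φ : FormalSeries) (j : Fin (n + 1)) :
    jet n φ j.succ = delta^[j] φ := rfl

theorem exponents_jet (n : ℕ) (φ : FormalSeries) (i : Fin (n + 2)) :
    exponents (jet n φ i) ⊆ insert 1 (exponents φ) := by
  refine Fin.cases (fun z hz => Or.inl ?_) (fun j z hz => Or.inr fun h => hz ?_) i
  · by_contra hne
    exact hz (HahnSeries.coeff_single_of_ne fun h => hne (expo_injective h))
  · change coeffAt (delta^[(j : ℕ)] φ) z = 0
    rw [coeffAt_iterate_delta, h, iterate_deltaCoeff_zero]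

theorem exists_jet_mem_reGE {φ : FormalSeries} (hφ : IsDulac φ) (n : ℕ) :
    ∃ c : ℝ, 0 < c ∧ ∀ i, jet n φ i ∈ reGE c := by
  choose c hc hcΦ using fun i => (hφ.jet n i).exists_pos_le
  obtain ⟨i₀, h₀⟩ := Finite.exists_min c
  exact ⟨c i₀, hc i₀, fun i z hz => (h₀ i).trans (hcΦ i z hz)⟩

theorem mem_closure_of_substCoeff_ne_zero {n : ℕ} {φ : FormalSeries} (hφ : IsDulac φ)
    (H : (Fin (n + 2) → ℂ) → ℂ) {z : ℂ} (hz : substCoeff H (jet n φ) z ≠ 0) :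
    z ∈ AddSubmonoid.closure (insert 1 (exponents φ)) := by
  obtain ⟨c, hc, hcΦ⟩ := exists_jet_mem_reGE hφ n
  obtain ⟨D, hD⟩ := exists_nat_gt (z.re / c)
  rw [← coeffAt_aeval_taylorSum H hc hcΦ ((div_lt_iff₀ hc).1 hD)] at hz
  exact aeval_mem_seriesAlgebra
    (fun i => (exponents_jet n φ i).trans AddSubmonoid.subset_closure) _ hz

/-- Let `P` be the part of the solution `φ` with exponents of real part less than `Re λ`. By Taylor
expansion at `φ`, the coefficient of `x^(λ + ν)` in `F(x, P, δ P, …)` is `- ∑ A_j (λ + d/dt)^j c_λ`: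
all other terms of `F'_{y_j} δ^j (P - φ)` have exponents of larger real part, and so have the
terms that are quadratic in `P - φ`, because `2 Re λ > Re λ + Re ν`. The coefficient is nonzero
unless `λ` is a root of `∑ A_j λ^j`, and the exponents of `F(x, P, δ P, …)` are sums of ones and of
exponents of `P`. -/
theorem add_mem_closure_of_mem_exponents {n : ℕ} {F : (Fin (n + 2) → ℂ) → ℂ} {φ : FormalSeries}
    (hF : AnalyticAt ℂ F 0) (hφ : IsDulac φ) (hsol : IsFormalSolution F φ) {ν : ℂ}
    {A : Fin (n + 1) → ℂ} (hlead : ∀ j, HasLeadingTerm F φ j ν (A j)) {z : ℂ}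
    (hz : z ∈ exponents φ) (hνz : ν.re < z.re) (hroot : ∑ j, A j * z ^ (j : ℕ) ≠ 0) :
    z + ν ∈ AddSubmonoid.closure (insert 1 {μ ∈ exponents φ | μ.re < z.re}) := by
  obtain ⟨c, hc, hcΦ⟩ := exists_jet_mem_reGE hφ n
  obtain ⟨D, hD⟩ := exists_nat_gt ((z + ν).re / c)
  rw [div_lt_iff₀ hc] at hD
  have hz0 := hφ.1 z hz
  set Φ := jet n φ with hΦ
  set Φ' := jet n (truncRe z.re φ) with hΦ'
  set Ψ : Fin (n + 2) → FormalSeries := Φ' - Φ with hΨ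
  have hΨ0 : Ψ 0 = 0 := by rw [hΨ, Pi.sub_apply, hΦ, hΦ', jet_zero, jet_zero, sub_self]
  have hΨcoeff : ∀ (j : Fin (n + 1)) (w : ℂ), coeffAt (Ψ j.succ) w =
      if w.re < z.re then 0 else -(deltaCoeff w)^[j] (coeffAt φ w) := fun j w => by
    have h : coeffAt (Ψ j.succ) w =
        coeffAt (delta^[(j : ℕ)] (truncRe z.re φ)) w - coeffAt (delta^[(j : ℕ)] φ) w := by
      rw [hΨ, Pi.sub_apply, hΦ, hΦ', jet_succ, jet_succ, coeffAt, HahnSeries.coeff_sub]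
      rfl
    rw [h, coeffAt_iterate_delta, coeffAt_iterate_delta, coeffAt_truncRe]
    split_ifs
    · rw [sub_self]
    · rw [iterate_deltaCoeff_zero, zero_sub]
  have hΨre : ∀ i, Ψ i ∈ reGE z.re := by
    refine Fin.cases (hΨ0 ▸ zero_mem _) fun j w hw => ?_
    by_contra! hlt
    exact hw (by rw [hΨcoeff, if_pos hlt])
  have hsum : Φ + Ψ = Φ' := add_sub_cancel _ _
  set p := taylorSum F (D + 1) with hp
  have hsolp : coeffAt (MvPolynomial.aeval Φ p) (z + ν) = 0 := by
    rw [coeffAt_aeval_taylorSum F hc hcΦ, hsol]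
    push_cast
    linarith
  have hlin : ∀ j : Fin (n + 1),
      coeffAt (MvPolynomial.aeval Φ (MvPolynomial.pderiv j.succ p) * Ψ j.succ) (z + ν) =
        -(Polynomial.C (A j) * (deltaCoeff z)^[j] (coeffAt φ z)) := fun j => by
    have hU : ∀ u : ℂ, u.re ≤ (z + ν).re →
        coeffAt (MvPolynomial.aeval Φ (MvPolynomial.pderiv j.succ p)) u =
          substCoeff (partialY F j) Φ u := fun u hu => by
      rw [hp, pderiv_taylorSum hF, coeffAt_aeval_taylorSum _ hc hcΦ (hu.trans_lt hD)]
      rfl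
    rw [add_comm z ν, coeffAt_mul_of_unique, hU ν (by simp [hz0.le]), (hlead j).1, hΨcoeff,
      if_neg (lt_irrefl _), mul_neg]
    intro u hu v hv huv
    have hre := congrArg Complex.re huv
    have hv' := hΨre _ v hv
    rw [Complex.add_re, Complex.add_re] at hre
    by_contra hne
    have hu' : coeffAt (MvPolynomial.aeval Φ (MvPolynomial.pderiv j.succ p)) u ≠ 0 := hu
    rw [hU u (by rw [Complex.add_re]; linarith)] at hu'
    linarith [(hlead j).2 u hne hu']
  have hmain : coeffAt (MvPolynomial.aeval Φ' p) (z + ν) =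
      -∑ j, Polynomial.C (A j) * (deltaCoeff z)^[j] (coeffAt φ z) := by
    rw [← hsum, coeffAt_aeval_add hz0.le (fun i => reGE_mono hc.le (hcΦ i)) hΨre p
      (by rw [Complex.add_re]; linarith), hsolp, zero_add, Fin.sum_univ_succ, hΨ0, mul_zero,
      Finset.sum_congr rfl fun j _ => hlin j, Finset.sum_neg_distrib]
    exact zero_add _
  refine aeval_mem_seriesAlgebra (Φ := Φ') (fun i => ?_) p
    (show coeffAt _ _ ≠ 0 from hmain ▸ neg_ne_zero.2 (sum_iterate_deltaCoeff_ne_zero hroot hz))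
  rw [← exponents_truncRe]
  exact (exponents_jet n _ i).trans AddSubmonoid.subset_closure

/-! ### Dulac series and power series in several variables -/

theorem linearCombination_eq_sum {κ : ℕ} (r : Fin κ → ℂ) (m : Fin κ →₀ ℕ) :
    Finsupp.linearCombination ℕ r m = ∑ j, (m j : ℂ) * r j := by
  simp [Finsupp.linearCombination_apply, Finsupp.sum_fintype]

theorem mem_semigroupGen_of_mem_closure {κ : ℕ} {r : Fin κ → ℂ} {z : ℂ}
    (hz : z ∈ AddSubmonoid.closure (Set.range r)) (h0 : z ≠ 0) : z ∈ semigroupGen r := by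
  rw [← Submodule.span_nat_eq_addSubmonoidClosure, Submodule.mem_toAddSubmonoid,
    Finsupp.mem_span_range_iff_exists_finsupp] at hz
  obtain ⟨m, rfl⟩ := hz
  refine ⟨m, ?_, linearCombination_eq_sum r m⟩
  rintro rfl
  exact h0 (by simp)

theorem linearCombination_mem_closure {κ : ℕ} (r : Fin κ → ℂ) (m : Fin κ →₀ ℕ) :
    Finsupp.linearCombination ℕ r m ∈ AddSubmonoid.closure (Set.range r) := by
  rw [← Submodule.span_nat_eq_addSubmonoidClosure, Submodule.mem_toAddSubmonoid]
  exact Finsupp.mem_span_range_iff_exists_finsupp.2 ⟨m, rfl⟩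

theorem re_linearCombination_pos {κ : ℕ} {r : Fin κ → ℂ} (hpos : ∀ j, 0 < (r j).re)
    {m : Fin κ →₀ ℕ} (hm : m ≠ 0) : 0 < (Finsupp.linearCombination ℕ r m).re := by
  obtain ⟨j, hj⟩ := Finsupp.ne_iff.1 hm
  rw [linearCombination_eq_sum, Complex.re_sum]
  refine Finset.sum_pos' (fun i _ => ?_) ⟨j, Finset.mem_univ j, ?_⟩
  · rw [← Complex.ofReal_natCast, Complex.re_ofReal_mul]
    exact mul_nonneg (Nat.cast_nonneg _) (hpos i).le
  · rw [← Complex.ofReal_natCast, Complex.re_ofReal_mul]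
    exact mul_pos (Nat.cast_pos.2 (Nat.pos_of_ne_zero hj)) (hpos j)

theorem linearCombination_injective {κ : ℕ} {r : Fin κ → ℂ} (hr : LinearIndependent ℤ r) :
    Function.Injective (Finsupp.linearCombination ℕ r) :=
  hr.restrict_scalars (R := ℕ) fun m n h => by simpa using h

/-- A set of exponents that has finitely many elements of bounded real part is well-ordered
lexicographically. -/
theorem isPWO_of_finite_re_le {s : Set Expo} (hs : ∀ N : ℝ, {e ∈ s | (ofLex e).1 ≤ N}.Finite) :
    s.IsPWO := by
  rw [Set.isPWO_iff_isWF, Set.isWF_iff_no_descending_seq]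
  intro f hf hfs
  refine Set.infinite_range_of_injective hf.injective
    ((hs (ofLex (f 0)).1).subset (Set.range_subset_iff.2 fun k => ⟨hfs k, ?_⟩))
  exact Prod.Lex.monotone_fst_ofLex (hf.antitone (Nat.zero_le k))

variable {κ : ℕ} {r : Fin κ → ℂ}

/-- The coefficient of `x_1^{m_1} ⋯ x_κ^{m_κ}` in the image of a Dulac series. -/
def toPowerSeriesFun (r : Fin κ → ℂ) (η : FormalSeries) :
    MvPowerSeries (Fin κ) (Polynomial ℂ) :=
  fun m => coeffAt η (Finsupp.linearCombination ℕ r m)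

theorem coeff_toPowerSeriesFun (η : FormalSeries) (m : Fin κ →₀ ℕ) :
    MvPowerSeries.coeff m (toPowerSeriesFun r η) =
      coeffAt η (Finsupp.linearCombination ℕ r m) := rfl

/-- Multiplicativity: since the `r_j` are linearly independent, the decompositions of the exponent
`∑ m_j r_j` inside the semigroup correspond to the decompositions of `m`. -/
theorem toPowerSeriesFun_mul (hr : LinearIndependent ℤ r) {η ξ : FormalSeries}
    (hη : exponents η ⊆ semigroupGen r) (hξ : exponents ξ ⊆ semigroupGen r) :
    toPowerSeriesFun r (η * ξ) = toPowerSeriesFun r η * toPowerSeriesFun r ξ := by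
  classical
  ext1 m
  rw [MvPowerSeries.coeff_mul, coeff_toPowerSeriesFun, coeffAt, HahnSeries.coeff_mul]
  have hinj := expo_injective.comp (linearCombination_injective hr)
  have hmem : ∀ {ζ : FormalSeries}, exponents ζ ⊆ semigroupGen r → ∀ {e : Expo},
      ζ.coeff e ≠ 0 → ∃ m, expo (Finsupp.linearCombination ℕ r m) = e := by
    intro ζ hζ e he
    obtain ⟨z, rfl⟩ := exists_expo e
    obtain ⟨m, -, rfl⟩ := hζ (show z ∈ exponents ζ from he)
    exact ⟨m, by rw [linearCombination_eq_sum]⟩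
  symm
  refine Finset.sum_bij_ne_zero (fun p _ _ => (expo (Finsupp.linearCombination ℕ r p.1),
    expo (Finsupp.linearCombination ℕ r p.2))) ?_ ?_ ?_ fun _ _ _ => rfl
  · intro p hp hne
    refine Finset.mem_antidiagonal.2
      ⟨left_ne_zero_of_mul hne, right_ne_zero_of_mul hne, ?_⟩
    rw [← Finset.HasAntidiagonal.mem_antidiagonal.1 hp, map_add]
    rfl
  · intro p _ _ q _ _ h
    exact Prod.ext (hinj (congrArg Prod.fst h)) (hinj (congrArg Prod.snd h))
  · rintro ⟨a, b⟩ hab hne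
    obtain ⟨u, rfl⟩ := hmem hη (left_ne_zero_of_mul hne)
    obtain ⟨v, rfl⟩ := hmem hξ (right_ne_zero_of_mul hne)
    refine ⟨(u, v), Finset.HasAntidiagonal.mem_antidiagonal.2 (hinj ?_), hne, rfl⟩
    rw [Function.comp_apply, Function.comp_apply, map_add, expo_add]
    exact (Finset.mem_antidiagonal.1 hab).2.2

theorem constantCoeff_toPowerSeriesFun {η : FormalSeries} (hη : IsDulac η) :
    MvPowerSeries.constantCoeff (toPowerSeriesFun r η) = 0 := by
  rw [← MvPowerSeries.coeff_zero_eq_constantCoeff_apply, coeff_toPowerSeriesFun]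
  by_contra h
  exact (hη.1 _ h).ne (by simp)

/-- The map `∑ C_m(t) x^{∑ m_j r_j} ↦ ∑ C_m(t) x_1^{m_1} ⋯ x_κ^{m_κ}`. -/
def toPowerSeries (hr : LinearIndependent ℤ r) :
    seriesRing (semigroupGen r) →ₙ+* powerSeriesRing κ where
  toFun η := ⟨toPowerSeriesFun r η, constantCoeff_toPowerSeriesFun η.2.1⟩
  map_mul' η ξ := Subtype.ext (toPowerSeriesFun_mul hr η.2.2 ξ.2.2)
  map_zero' := rfl
  map_add' _ _ := rfl

theorem toPowerSeries_injective (hr : LinearIndependent ℤ r) :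
    Function.Injective (toPowerSeries hr) := by
  intro η ξ h
  have hc : ∀ m, coeffAt (η : FormalSeries) (Finsupp.linearCombination ℕ r m) =
      coeffAt (ξ : FormalSeries) (Finsupp.linearCombination ℕ r m) :=
    congrFun (congrArg Subtype.val h)
  refine Subtype.ext (HahnSeries.ext (funext fun e => ?_))
  obtain ⟨z, rfl⟩ := exists_expo e
  by_cases hz : z ∈ semigroupGen r
  · obtain ⟨m, -, rfl⟩ := hz
    rw [← linearCombination_eq_sum]
    exact hc m
  · have h1 : coeffAt (η : FormalSeries) z = 0 := by_contra fun h => hz (η.2.2 h)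
    have h2 : coeffAt (ξ : FormalSeries) z = 0 := by_contra fun h => hz (ξ.2.2 h)
    exact h1.trans h2.symm

theorem toPowerSeries_surjective (hr : LinearIndependent ℤ r) (hpos : ∀ j, 0 < (r j).re) :
    Function.Surjective (toPowerSeries hr) := by
  rintro ⟨f, hf⟩
  have hinj : Function.Injective fun m => expo (Finsupp.linearCombination ℕ r m) :=
    expo_injective.comp (linearCombination_injective hr)
  set c : Expo → Polynomial ℂ :=
    Function.extend (fun m => expo (Finsupp.linearCombination ℕ r m)) f 0 with hc
  have hcm : ∀ m, c (expo (Finsupp.linearCombination ℕ r m)) = f m := hinj.extend_apply f 0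
  have hsupp : ∀ z, c (expo z) ≠ 0 → ∃ m, m ≠ 0 ∧ Finsupp.linearCombination ℕ r m = z := by
    intro z hz
    by_cases hex : ∃ m, expo (Finsupp.linearCombination ℕ r m) = expo z
    · obtain ⟨m, hm⟩ := hex
      refine ⟨m, ?_, expo_injective hm⟩
      rintro rfl
      exact hz (by rw [← hm, hcm]; exact hf)
    · exact absurd (Function.extend_apply' _ _ _ hex) hz
  have hfin : ∀ N : ℝ, {z | c (expo z) ≠ 0 ∧ z.re ≤ N}.Finite := fun N =>
    (finite_closure_re_le (Set.finite_range r) (Set.forall_mem_range.2 hpos) N).subset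
      fun z ⟨hz, hN⟩ => by
        obtain ⟨m, -, rfl⟩ := hsupp z hz
        exact ⟨linearCombination_mem_closure r m, hN⟩
  have hpwo : (Function.support c).IsPWO := isPWO_of_finite_re_le fun N =>
    ((hfin N).image expo).subset fun e ⟨he, hN⟩ => by
      obtain ⟨z, rfl⟩ := exists_expo e
      exact ⟨z, ⟨he, hN⟩, rfl⟩
  refine ⟨⟨⟨c, hpwo⟩, ⟨fun z hz => ?_, hfin⟩, fun z hz => ?_⟩, Subtype.ext (funext hcm)⟩
  · obtain ⟨m, hm, rfl⟩ := hsupp z hz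
    exact re_linearCombination_pos hpos hm
  · obtain ⟨m, hm, rfl⟩ := hsupp z hz
    exact ⟨m, hm, linearCombination_eq_sum r m⟩

/-! ### The generators for a formal solution -/

theorem mem_closure_re_le {S : Set ℂ} (hS : ∀ s ∈ S, 0 ≤ s.re) {z : ℂ}
    (hz : z ∈ AddSubmonoid.closure S) :
    z ∈ AddSubmonoid.closure {s ∈ S | s.re ≤ z.re} := by
  have hnn : ∀ z ∈ AddSubmonoid.closure S, 0 ≤ z.re := fun z hz =>
    (AddSubmonoid.closure_le (S := reNonneg)).2 hS hz
  induction hz using AddSubmonoid.closure_induction with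
  | mem x hx => exact AddSubmonoid.subset_closure ⟨hx, le_rfl⟩
  | zero => exact zero_mem _
  | add x y hx hy ihx ihy =>
    have h1 := hnn x hx
    have h2 := hnn y hy
    refine add_mem (AddSubmonoid.closure_mono ?_ ihx) (AddSubmonoid.closure_mono ?_ ihy)
    · exact fun s hs => ⟨hs.1, hs.2.trans (by rw [Complex.add_re]; linarith)⟩
    · exact fun s hs => ⟨hs.1, hs.2.trans (by rw [Complex.add_re]; linarith)⟩

/-- The nonzero polynomial `∑ A_j λ^j` has no root of large real part. -/
theorem exists_re_bound_of_root {n : ℕ} {A : Fin n → ℂ} {l : Fin n} (hl : A l ≠ 0) :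
    ∃ N : ℝ, ∀ z : ℂ, N < z.re → ∑ j, A j * z ^ (j : ℕ) ≠ 0 := by
  set Q : Polynomial ℂ := ∑ j : Fin n, Polynomial.monomial (j : ℕ) (A j) with hQ
  have hQ0 : Q ≠ 0 := fun h => hl (by
    have := congrArg (fun p => Polynomial.coeff p l) h
    simpa [hQ, Polynomial.finsetSum_coeff, Polynomial.coeff_monomial, Fin.val_inj] using this)
  obtain ⟨N, hN⟩ := (Q.roots.toFinset.finite_toSet.image Complex.re).bddAbove
  refine ⟨N, fun z hz h => hz.not_ge (hN ⟨z, ?_, rfl⟩)⟩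
  have hev : Q.eval z = 0 := by simpa [hQ, Polynomial.eval_finsetSum] using h
  simpa [hQ0] using hev

/-- The exponents of a formal solution lie in a finitely generated monoid. -/
theorem exists_finite_generators_of_isFormalSolution {n : ℕ} {F : (Fin (n + 2) → ℂ) → ℂ}
    {φ : FormalSeries} (hF : AnalyticAt ℂ F 0) (hφ : IsDulac φ) (hsol : IsFormalSolution F φ)
    {ν : ℂ} {A : Fin (n + 1) → ℂ} (hlead : ∀ j, HasLeadingTerm F φ j ν (A j)) {l : Fin (n + 1)}
    (hl : A l ≠ 0) :
    ∃ Z : Set ℂ, Z.Finite ∧ (∀ z ∈ Z, 0 < z.re) ∧ 1 ∈ Z ∧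
      ∀ z ∈ exponents φ, z ∈ AddSubmonoid.closure Z := by
  obtain ⟨N, hN⟩ := exists_re_bound_of_root hl
  have hν : ν ∈ AddSubmonoid.closure (insert 1 (exponents φ)) :=
    mem_closure_of_substCoeff_ne_zero hφ (partialY F l)
      (by rw [(hlead l).1]; exact Polynomial.C_ne_zero.2 hl)
  refine exists_finite_generators hφ.1 hφ.2 (le_max_right N ν.re) ?_ fun z hz hNz =>
    add_mem_closure_of_mem_exponents hF hφ hsol hlead hz ((le_max_right _ _).trans_lt hNz)
      (hN z ((le_max_left _ _).trans_lt hNz))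
  refine AddSubmonoid.closure_mono ?_ (mem_closure_re_le ?_ hν)
  · rintro s ⟨rfl | hs, hsν⟩
    exacts [Or.inl rfl, Or.inr ⟨hs, hsν.trans (le_max_right _ _)⟩]
  · rintro s (rfl | hs)
    exacts [by simp, (hφ.1 s hs).le]

theorem pos_of_mem_slopeSet {n : ℕ} {F : (Fin (n + 2) → ℂ) → ℂ} {φ : FormalSeries} {ν : ℂ}
    {A : Fin (n + 1) → ℂ} (hlead : ∀ j, HasLeadingTerm F φ j ν (A j)) {l : Fin (n + 1)}
    (hl : IsGreatest {j | A j ≠ 0} l) {s : ℝ} (hs : s ∈ slopeSet F φ ν l) :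
    0 < ((n : ℝ) - l) * s := by
  obtain ⟨j, hlj, z, hz, rfl⟩ := hs
  have hA : A j = 0 := by_contra fun h => hlj.not_ge (hl.2 h)
  have hzν : z ≠ ν := by
    rintro rfl
    exact hz (by rw [(hlead j).1, hA, Polynomial.C_0])
  have h1 : (l : ℝ) < j := by exact_mod_cast hlj
  have h2 : (j : ℝ) ≤ n := by exact_mod_cast j.is_le
  exact mul_pos (by linarith) (div_pos (sub_pos.2 ((hlead j).2 z hzν hz)) (sub_pos.2 h1))

end Dulac

end

theorem mainTheorem2 (n : ℕ) (F : (Fin (n + 2) → ℂ) → ℂ) (φ : Dulac.FormalSeries)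
    (hF : AnalyticAt ℂ F 0) (hF0 : F 0 = 0) (hFne : ¬ F =ᶠ[nhds 0] 0)
    (hφ : Dulac.IsDulac φ) (hφne : φ ≠ 0)
    (hsol : Dulac.IsFormalSolution F φ)
    (hsep : ∃ z : ℂ, Dulac.substCoeff (Dulac.partialY F (Fin.last n)) (Dulac.jet n φ) z ≠ 0)
    (ν : ℂ) (A : Fin (n + 1) → ℂ)
    (hlead : ∀ j, Dulac.HasLeadingTerm F φ j ν (A j))
    (l : Fin (n + 1)) (hl : IsGreatest {j | A j ≠ 0} l) :
    ∃ (κ : ℕ) (r : Fin κ → ℂ),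
      LinearIndependent ℤ r ∧ (∀ j, 0 < (r j).re) ∧
      1 ∈ Dulac.semigroupGen r ∧
      (∀ s : ℝ, IsLeast (Dulac.slopeSet F φ ν l) s →
        ((((n : ℝ) - (l : ℝ)) * s : ℝ) : ℂ) ∈ Dulac.semigroupGen r) ∧
      φ ∈ Dulac.seriesRing (Dulac.semigroupGen r) ∧
      ∃ ι : Dulac.seriesRing (Dulac.semigroupGen r) ≃+* Dulac.powerSeriesRing κ,
        ∀ (η : Dulac.seriesRing (Dulac.semigroupGen r)) (m : Fin κ →₀ ℕ), m ≠ 0 →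
          MvPowerSeries.coeff m (ι η : MvPowerSeries (Fin κ) (Polynomial ℂ)) =
            Dulac.coeffAt η (∑ j, (m j : ℂ) * r j) := by
  obtain ⟨Z, hZ, hZpos, hZ1, hφZ⟩ :=
    Dulac.exists_finite_generators_of_isFormalSolution hF hφ hsol hlead hl.1
  -- The least slope, if there is one, contributes one further generator.
  set W : Set ℂ := (fun s : ℝ => (((n : ℝ) - (l : ℝ)) * s : ℝ)) ''
    {s | IsLeast (Dulac.slopeSet F φ ν l) s} with hW
  have hWfin : W.Finite := Set.Subsingleton.finite
    (Set.Subsingleton.image (fun _ h _ h' => h.unique h') _)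
  have hWpos : ∀ z ∈ W, 0 < z.re := by
    rintro _ ⟨s, hs, rfl⟩
    simpa using Dulac.pos_of_mem_slopeSet hlead hl hs.1
  have hpos : ∀ z ∈ Z ∪ W, 0 < z.re := fun z hz => hz.elim (hZpos z) (hWpos z)
  obtain ⟨κ, r, hr, hrpos, hZr⟩ := Dulac.exists_linearIndependent_generators (hZ.union hWfin) hpos
  have hmem : ∀ z ∈ AddSubmonoid.closure (Set.range r), 0 < z.re → z ∈ Dulac.semigroupGen r :=
    fun z hz h => Dulac.mem_semigroupGen_of_mem_closure hz (by rintro rfl; simp at h)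
  have hZr' : AddSubmonoid.closure Z ≤ AddSubmonoid.closure (Set.range r) :=
    AddSubmonoid.closure_le.2 (Set.subset_union_left.trans hZr)
  refine ⟨κ, r, hr, hrpos, hmem 1 (hZr (Or.inl hZ1)) (by simp), fun s hs => ?_,
    ⟨hφ, fun z hz => hmem z (hZr' (hφZ z hz)) (hφ.1 z hz)⟩,
    RingEquiv.ofBijective (Dulac.toPowerSeries hr)
      ⟨Dulac.toPowerSeries_injective hr, Dulac.toPowerSeries_surjective hr hrpos⟩,
    fun η m _ => ?_⟩
  · have hsW : ((((n : ℝ) - (l : ℝ)) * s : ℝ) : ℂ) ∈ W := ⟨s, hs, rfl⟩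
    exact hmem _ (hZr (Or.inr hsW)) (hWpos _ hsW)
  · rw [← Dulac.linearCombination_eq_sum]
    rfl
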